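/- Setting. Fix a metric space $M$ and an opening cost $f \ge 0$. In online facility location, clients $v_1,\dots,v_n \in M$ arrive one by one. The elements that can be bought are facilities $x \in M$, at price $f$ each, and connections $(x,v)\in M\times M$, at price $d(x,v)$; costs are additive. A set $S$ of elements is feasible for a set $D\subseteq M$ of clients if every $v\in D$ has some $x$ with $x\in S$ and $(x,v)\in S$ (it is connected to an open facility). A deterministic online algorithm buys, on the arrival of $v_i$, a set $S_i$ that depends only on $v_1,\dots,v_i$, such that $S_1\cup\dots\cup S_i$ is feasible for $\{v_1,\dots,v_i\}$; its cost $\mathrm{ALG}(v)$ is the cost of $S_1\cup\dots\cup S_n$. A randomized online algorithm is a random deterministic one, drawn independently of the arrivals. $\mathrm{OPT}(v)$ is the minimum cost of a set that is feasible for $\{v_1,\dots,v_n\}$. A Markov random field (MRF) on a finite product $\Omega=\Omega_1\times\dots\times\Omega_n$ consists of a set $H$ of subsets of $\{1,\dots,n\}$ (hyperedges), potentials $\psi_i:\Omega_i\to\mathbb{R}$, and potentials $\psi_e:\prod_{i\in e}\Omega_i\to\mathbb{R}$ for $e\in H$. It defines the distribution $\Pr[u]\propto\exp\big(\sum_i\psi_i(u_i)+\sum_{e\in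 H}\psi_e((u_i)_{i\in e})\big)$ on $\Omega$, and its weighted maximum degree is $\max_i\max_{u\in\Omega}\big|\sum_{e\in H,\,e\ni i}\psi_e((u_j)_{j\in e})\big|$. A distribution given by an MRF of weighted maximum degree $\Delta$ is called a $\Delta$-MRF distribution. Theorem. There is an absolute constant $c>0$ such that for every real $\Delta\ge 2$ there are a finite metric space $M$, a (uniform) opening cost $f$, a number $n$ of arrivals, pairwise disjoint sets $\Omega_1,\dots,\Omega_n\subseteq M$, and a $\Delta$-MRF distribution $\mathcal{D}$ on $\Omega_1\times\dots\times\Omega_n$ such that $\mathbb{E}_{v\sim\mathcal{D}}[\mathrm{OPT}(v)]>0$ and every (deterministic or randomized) online algorithm, even one that knows the whole instance and $\mathcal{D}$, satisfies \[ \mathbb{E}_{v\sim\mathcal{D}}[\mathrm{ALG}(v)]\;\ge\; c\cdot\frac{\Delta}{\log\Delta}\cdot\mathbb{E}_{v\sim\mathcal{D}}[\mathrm{OPT}(v)]. \] (As the sets $\Omega_i$ are pairwise disjoint, the clients are always pairwise distinct points, so it does not matter whether repeated clients at one point would have to be connected once or several times.) -/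

import Mathlib

open scoped NNReal
open MeasureTheory

/-! ### Markov random fields on finite type spaces -/

/-- A Markov random field on `Ω 0 × ⋯ × Ω (n-1)`: a hypergraph on the coordinates, a potential on
every coordinate and a potential on every hyperedge (values of `edgePot e` for `e ∉ edges` are
never used). -/
structure MRF {n : ℕ} (Ω : Fin n → Type) where
  /-- the hyperedges -/
  edges : Finset (Finset (Fin n))
  /-- the coordinate potentials -/
  vertexPot : (i : Fin n) → Ω i → ℝ
  /-- the hyperedge potentials -/
  edgePot : (e : Finset (Fin n)) → ((i : e) → Ω i) → ℝ

namespace MRF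

variable {n : ℕ} {Ω : Fin n → Type}

/-- `exp (∑ᵢ ψᵢ(uᵢ) + ∑ₑ ψₑ((uᵢ)_{i ∈ e}))`. -/
noncomputable def weight (X : MRF Ω) (u : (i : Fin n) → Ω i) : ℝ :=
  Real.exp (∑ i, X.vertexPot i (u i) + ∑ e ∈ X.edges, X.edgePot e (fun i => u i))

/-- The probability of `u` under the distribution of the field: the normalized weight. -/
noncomputable def prob [∀ i, Fintype (Ω i)] (X : MRF Ω) (u : (i : Fin n) → Ω i) : ℝ :=
  X.weight u / ∑ w, X.weight w

/-- The expectation of `g` under the distribution of the field. -/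
noncomputable def expect [∀ i, Fintype (Ω i)] (X : MRF Ω) (g : ((i : Fin n) → Ω i) → ℝ) : ℝ :=
  ∑ u, X.prob u * g u

/-- The weighted maximum degree `max_i max_u |∑_{e ∋ i} ψₑ((uⱼ)_{j ∈ e})|`. -/
noncomputable def weightedDegree (X : MRF Ω) : ℝ :=
  ⨆ p : Fin n × ((i : Fin n) → Ω i),
    |∑ e ∈ X.edges with p.1 ∈ e, X.edgePot e (fun i => p.2 i)|

end MRF

/-! ### Subadditive coverage problems and online algorithms -/

/-- A subadditive coverage problem with demand points `V` and ground set of elements `E`. -/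
structure CoverageProblem (V E : Type) [DecidableEq V] [DecidableEq E] where
  /-- the collection of feasible solutions for a demand set -/
  feasible : Finset V → Set (Finset E)
  /-- the cost of buying a set of elements -/
  cost : Finset E → ℝ
  feasible_union : ∀ {D₁ D₂ : Finset V} {S₁ S₂ : Finset E},
    S₁ ∈ feasible D₁ → S₂ ∈ feasible D₂ → S₁ ∪ S₂ ∈ feasible (D₁ ∪ D₂)
  feasible_anti : ∀ {D₁ D₂ : Finset V}, D₁ ⊆ D₂ → feasible D₂ ⊆ feasible D₁
  cost_nonneg : ∀ S, 0 ≤ cost S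
  cost_mono : ∀ {S₁ S₂ : Finset E}, S₁ ⊆ S₂ → cost S₁ ≤ cost S₂
  cost_union_le : ∀ S₁ S₂, cost (S₁ ∪ S₂) ≤ cost S₁ + cost S₂

section Online

variable {V E : Type} [DecidableEq V] [DecidableEq E]

/-- The offline optimum for the demands `v 0, …, v (n-1)`. -/
noncomputable def CoverageProblem.opt (P : CoverageProblem V E) {n : ℕ} (v : Fin n → V) : ℝ :=
  ⨅ S : P.feasible (Finset.univ.image v), P.cost S

/-- A deterministic online algorithm for `n` arrivals: on arrival of `v i` it irrevocably buys the
set `select v i`, which depends only on the demands `v 0, …, v i` seen so far, and the elements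
bought so far must then be feasible for the demands seen so far. -/
structure OnlineAlgorithm (P : CoverageProblem V E) (n : ℕ) where
  /-- the elements bought in each step -/
  select : (Fin n → V) → Fin n → Finset E
  causal : ∀ (v w : Fin n → V) (i : Fin n), (∀ j ≤ i, v j = w j) → select v i = select w i
  feasible : ∀ (v : Fin n → V) (i : Fin n),
    (Finset.Iic i).biUnion (select v) ∈ P.feasible ((Finset.Iic i).image v)

/-- The total cost of an online algorithm: the cost of everything it has bought at the end. -/
noncomputable def OnlineAlgorithm.cost {P : CoverageProblem V E} {n : ℕ}
    (A : OnlineAlgorithm P n) (v : Fin n → V) : ℝ :=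
  P.cost (Finset.univ.biUnion (A.select v))

end Online

/-! ### Facility location -/

/-- The price of an element of facility location: opening the facility `Sum.inl x` costs
`openCost x`, and the connection `Sum.inr (x, v)` between facility `x` and client `v` costs
`dist x v`. -/
noncomputable def elementCost {M : Type} [MetricSpace M] (openCost : M → ℝ≥0) :
    M ⊕ (M × M) → ℝ
  | Sum.inl x => openCost x
  | Sum.inr (x, v) => dist x v

theorem elementCost_nonneg {M : Type} [MetricSpace M] (openCost : M → ℝ≥0)
    (e : M ⊕ (M × M)) : 0 ≤ elementCost openCost e := by
  cases e with
  | inl x => exact (openCost x).2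
  | inr p => exact dist_nonneg

/-- Facility location on a metric space `M`: clients and facilities are points of `M`, a set of
open facilities and connections is feasible for a set of clients if each of these clients is
connected to an open facility, and costs are additive. -/
noncomputable def facilityLocation (M : Type) [DecidableEq M] [MetricSpace M]
    (openCost : M → ℝ≥0) : CoverageProblem M (M ⊕ (M × M)) where
  feasible D := {S | ∀ v ∈ D, ∃ x : M, Sum.inl x ∈ S ∧ Sum.inr (x, v) ∈ S}
  cost S := ∑ e ∈ S, elementCost openCost e
  feasible_union := by
    intro D₁ D₂ S₁ S₂ h₁ h₂ v hv
    rcases Finset.mem_union.1 hv with hv | hv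
    · obtain ⟨x, hx, hxv⟩ := h₁ v hv
      exact ⟨x, Finset.mem_union_left _ hx, Finset.mem_union_left _ hxv⟩
    · obtain ⟨x, hx, hxv⟩ := h₂ v hv
      exact ⟨x, Finset.mem_union_right _ hx, Finset.mem_union_right _ hxv⟩
  feasible_anti := fun h _ hS v hv => hS v (h hv)
  cost_nonneg := fun _ => Finset.sum_nonneg fun e _ => elementCost_nonneg openCost e
  cost_mono := fun h =>
    Finset.sum_le_sum_of_subset_of_nonneg h fun e _ _ => elementCost_nonneg openCost e
  cost_union_le := fun S₁ S₂ => by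
    rw [← Finset.sum_union_inter]
    exact le_add_of_nonneg_right (Finset.sum_nonneg fun e _ => elementCost_nonneg openCost e)

/-! The hard input is a random root-to-leaf path in a binary tree of depth h. Distances shrink by a
factor h + 1 per level, while the batches of clients at the successive vertices of the path grow by
it. One facility at the final leaf serves each batch at cost at most h + 1, so with f = h(h + 1) the
optimum on a path is at most f + (h + 1)^2 = O(f).

An online algorithm does not know the next bit. Compare a path with the one obtained by flipping bit
i: until batch i + 1 both see the same clients and have the same open facilities. If one of these
lies in the subtree that one path enters, the other path abandons it. Otherwise batch i + 1 forces a
new facility in the subtree or connections leaving it, worth f either way. A facility is charged at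
most twice, once as new and once as abandoned, so the average cost over all paths is at least hf/4
(`le_charge_add_charge`, `sum_charge_le`, `le_sum_cost_path`).

The random path is approximated by a Markov chain: a potential θ = Δ/2 rewards each pair of
consecutive clients that follows the tree. A client lies in at most two pairs, so the degree is Δ
however many clients there are. Paths have equal weights. Repairing a broken transition gains a
factor e^θ and is at most 2^h to one, so a path is left with probability at most N 2^h e^{-θ}. With
N + 1 = (h + 1)^(h + 1) clients, θ of order h log h outweighs even the trivial bound (N + 1)f on the
optimum off the paths (`escape_le`). Hence h may be of order Δ / log Δ. -/

/-- The parameters of a hierarchically separated binary tree of depth `h` with an online sequence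
of `N + 1` clients, the `j`-th of which appears at a vertex of depth `level j`. Two points whose
lowest common ancestor has depth `i` are at distance `scale i`. -/
structure HardTree where
  N : ℕ
  h : ℕ
  level : Fin (N + 1) → ℕ
  scale : ℕ → ℝ
  level_mono : Monotone level
  level_last : level (Fin.last N) = h
  scale_pos : ∀ i, 0 < scale i
  scale_anti : Antitone scale

/-! ### The tree metric -/

namespace HardTree

variable (I : HardTree)

theorem level_le (j : Fin (I.N + 1)) : I.level j ≤ I.h :=
  I.level_last ▸ I.level_mono (Fin.le_last j)

/-- Root-to-leaf paths. -/
abbrev Bits : Type := Fin I.h → ZMod 2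

/-- The points of the metric space: `(j, a)` hangs below the vertex of depth `level j` on the
path `a`. -/
def Pt : Type := Fin (I.N + 1) × I.Bits

instance : DecidableEq I.Pt := inferInstanceAs (DecidableEq (Fin (I.N + 1) × I.Bits))

instance : Fintype I.Pt := inferInstanceAs (Fintype (Fin (I.N + 1) × I.Bits))

variable {I}

/-- Two paths agree in their first `k` steps. -/
def Agree (k : ℕ) (a b : I.Bits) : Prop := ∀ t : Fin I.h, (t : ℕ) < k → a t = b t

theorem Agree.refl (k : ℕ) (a : I.Bits) : Agree k a a := fun _ _ => rfl

theorem Agree.symm {k : ℕ} {a b : I.Bits} (h : Agree k a b) : Agree k b a :=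
  fun t ht => (h t ht).symm

theorem Agree.trans {k : ℕ} {a b c : I.Bits} (h : Agree k a b) (h' : Agree k b c) :
    Agree k a c := fun t ht => (h t ht).trans (h' t ht)

theorem Agree.mono {k l : ℕ} {a b : I.Bits} (h : Agree l a b) (hkl : k ≤ l) : Agree k a b :=
  fun t ht => h t (ht.trans_le hkl)

/-- The first `k` steps of a path, continued by zeros. -/
def trunc (k : ℕ) (a : I.Bits) : I.Bits := fun t => if (t : ℕ) < k then a t else 0

theorem trunc_of_lt {k : ℕ} {t : Fin I.h} (a : I.Bits) (ht : (t : ℕ) < k) : trunc k a t = a t :=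
  if_pos ht

theorem agree_trunc (k : ℕ) (a : I.Bits) : Agree k (trunc k a) a := fun _ ht => trunc_of_lt a ht

theorem trunc_eq_iff {k : ℕ} {a b : I.Bits} : trunc k a = trunc k b ↔ Agree k a b := by
  refine ⟨fun h => (agree_trunc k a).symm.trans (h ▸ agree_trunc k b), fun h => ?_⟩
  funext t
  unfold trunc
  split_ifs with ht
  exacts [h t ht, rfl]

theorem trunc_trunc (k : ℕ) (a : I.Bits) : trunc k (trunc k a) = trunc k a :=
  trunc_eq_iff.2 (agree_trunc k a)

open Classical in
/-- The depth of the lowest common ancestor of two points. -/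
noncomputable def meet (p q : I.Pt) : ℕ :=
  Nat.findGreatest (fun k => k ≤ I.level p.1 ∧ k ≤ I.level q.1 ∧ Agree k p.2 q.2) I.h

theorem le_meet_iff {p q : I.Pt} {k : ℕ} :
    k ≤ meet p q ↔ k ≤ I.level p.1 ∧ k ≤ I.level q.1 ∧ Agree k p.2 q.2 := by
  classical
  constructor
  · intro h
    have := Nat.findGreatest_spec
      (P := fun k => k ≤ I.level p.1 ∧ k ≤ I.level q.1 ∧ Agree k p.2 q.2) (n := I.h)
      (Nat.zero_le _) ⟨Nat.zero_le _, Nat.zero_le _, fun t ht => absurd ht (Nat.not_lt_zero _)⟩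
    exact ⟨h.trans this.1, h.trans this.2.1, this.2.2.mono h⟩
  · intro h
    exact Nat.le_findGreatest (h.1.trans (I.level_le _)) h

theorem meet_comm (p q : I.Pt) : meet p q = meet q p := by
  refine eq_of_forall_le_iff fun k => ?_
  rw [le_meet_iff, le_meet_iff]
  exact ⟨fun h => ⟨h.2.1, h.1, h.2.2.symm⟩, fun h => ⟨h.2.1, h.1, h.2.2.symm⟩⟩

theorem min_meet_le (p q r : I.Pt) : min (meet p q) (meet q r) ≤ meet p r := by
  have h₁ := le_meet_iff.1 (min_le_left (meet p q) (meet q r))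
  have h₂ := le_meet_iff.1 (min_le_right (meet p q) (meet q r))
  exact le_meet_iff.2 ⟨h₁.1, h₂.2.1, h₁.2.2.trans h₂.2.2⟩

/-- An ultrametric. Equal points are treated separately because `scale (meet p p)` is positive; this
keeps different clients at one vertex apart. -/
noncomputable instance : MetricSpace I.Pt where
  dist p q := if p = q then 0 else I.scale (meet p q)
  dist_self p := if_pos rfl
  dist_comm p q := by simp only [eq_comm, meet_comm]
  dist_triangle p q r := by
    by_cases hpq : p = q
    · subst hpq; simp
    by_cases hqr : q = r
    · subst hqr; simp
    rw [if_neg hpq, if_neg hqr]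
    have h₁ := I.scale_pos (meet p q)
    have h₂ := I.scale_pos (meet q r)
    split_ifs
    · positivity
    · have h := I.scale_anti (min_meet_le p q r)
      rcases min_choice (meet p q) (meet q r) with h' | h' <;> rw [h'] at h <;> linarith
  eq_of_dist_eq_zero {p q} h := by
    by_contra hpq
    change (if p = q then 0 else I.scale (meet p q)) = 0 at h
    rw [if_neg hpq] at h
    exact (I.scale_pos _).ne' h

theorem dist_def (p q : I.Pt) : dist p q = if p = q then 0 else I.scale (meet p q) := rfl

theorem dist_le_scale (p q : I.Pt) : dist p q ≤ I.scale (meet p q) := by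
  rw [dist_def]
  split_ifs
  exacts [(I.scale_pos _).le, le_rfl]

/-! ### Arrival sequences and paths -/

variable (I) in
/-- The possible positions of the `i`-th client. -/
def types (i : Fin (I.N + 1)) : Finset I.Pt :=
  Finset.univ.image fun g : I.Bits => ((i, trunc (I.level i) g) : I.Pt)

theorem mem_types {i : Fin (I.N + 1)} {p : I.Pt} :
    p ∈ I.types i ↔ ∃ g : I.Bits, ((i, trunc (I.level i) g) : I.Pt) = p :=
  Finset.mem_image.trans ⟨fun ⟨g, _, hg⟩ => ⟨g, hg⟩, fun ⟨g, hg⟩ => ⟨g, Finset.mem_univ g, hg⟩⟩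

theorem types_disjoint : Pairwise fun i j => Disjoint (I.types i) (I.types j) := by
  intro i j hij
  rw [Finset.disjoint_left]
  intro p hi hj
  obtain ⟨g, rfl⟩ := mem_types.1 hi
  obtain ⟨g', hg⟩ := mem_types.1 hj
  exact hij (congrArg Prod.fst hg).symm

variable (I) in
/-- The sequences of clients that can arrive. -/
abbrev Arrivals : Type := (i : Fin (I.N + 1)) → I.types i

/-- The vertex of the tree at which the `i`-th client appears. -/
def bits (u : I.Arrivals) (i : Fin (I.N + 1)) : I.Bits := (u i).1.2

theorem coe_arrival (u : I.Arrivals) (i : Fin (I.N + 1)) :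
    (u i : I.Pt) = ((i, bits u i) : I.Pt) := by
  obtain ⟨g, hg⟩ := mem_types.1 (u i).2
  exact Prod.ext (congrArg Prod.fst hg).symm rfl

theorem trunc_bits (u : I.Arrivals) (i : Fin (I.N + 1)) :
    trunc (I.level i) (bits u i) = bits u i := by
  obtain ⟨g, hg⟩ := mem_types.1 (u i).2
  have : bits u i = trunc (I.level i) g := (congrArg Prod.snd hg).symm
  rw [this, trunc_trunc]

theorem arrivals_ext {u w : I.Arrivals} (h : ∀ i, Agree (I.level i) (bits u i) (bits w i)) :
    u = w := by
  funext i
  refine Subtype.ext ?_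
  rw [coe_arrival, coe_arrival, ← trunc_bits u, ← trunc_bits w, trunc_eq_iff.2 (h i)]

/-- The arrivals at the vertices given by `a`. -/
def ofBits (a : Fin (I.N + 1) → I.Bits) : I.Arrivals := fun i =>
  ⟨(i, trunc (I.level i) (a i)), mem_types.2 ⟨a i, rfl⟩⟩

/-- The arrivals along the path `g`. -/
def path (g : I.Bits) : I.Arrivals := ofBits fun _ => g

/-- The last client sits at full depth and reveals the whole path. -/
theorem path_injective : Function.Injective (path : I.Bits → I.Arrivals) := by
  intro g g' h
  have h' : trunc (I.level (Fin.last I.N)) g = trunc (I.level (Fin.last I.N)) g' :=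
    congrArg (fun u : I.Arrivals => bits u (Fin.last I.N)) h
  rw [trunc_eq_iff, I.level_last] at h'
  exact funext fun t => h' t t.2

/-- The `j`-th transition of the arrivals follows the edges of the tree. -/
def Follows (u : I.Arrivals) (j : Fin I.N) : Prop :=
  Agree (I.level j.castSucc) (bits u j.castSucc) (bits u j.succ)

theorem follows_path (g : I.Bits) (j : Fin I.N) : Follows (path g) j :=
  (agree_trunc _ g).trans
    ((agree_trunc _ g).symm.mono (I.level_mono (Fin.castSucc_le_succ j)))

/-- Backward induction: levels increase, so each client's vertex determines that of the client
before it. -/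
theorem eq_path_of_follows {u : I.Arrivals} (hu : ∀ j, Follows u j) :
    u = path (bits u (Fin.last I.N)) := by
  refine arrivals_ext fun i => ?_
  refine Agree.trans ?_ (agree_trunc _ _).symm
  induction i using Fin.reverseInduction with
  | last => exact Agree.refl _ _
  | cast j ih =>
    exact (hu j).trans (ih.mono (I.level_mono (Fin.castSucc_le_succ j)))

open Classical in
theorem sum_follows (F : I.Arrivals → ℝ) :
    ∑ u with ∀ j, Follows u j, F u = ∑ g : I.Bits, F (path g) := by
  have : (Finset.univ.filter fun u : I.Arrivals => ∀ j, Follows u j) =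
      Finset.univ.image path := by
    ext u
    simp only [Finset.mem_filter, Finset.mem_univ, true_and, Finset.mem_image]
    exact ⟨fun h => ⟨_, (eq_path_of_follows h).symm⟩, fun ⟨g, hg⟩ => hg ▸ follows_path g⟩
  rw [this, Finset.sum_image fun _ _ _ _ h => path_injective h]

/-! ### The Markov chain and its weighted degree -/

open Classical in
variable (I) in
/-- The chain that favours arrivals along a path by a potential `θ` on every pair of consecutive
clients. -/
noncomputable def chain (θ : ℝ) : MRF (fun i => I.types i) where
  edges := Finset.univ.image fun j : Fin I.N => {j.castSucc, j.succ}
  vertexPot _ _ := 0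
  -- Stated for any hyperedge; on two consecutive clients only the comparison of the earlier with
  -- the later has content, and it is `Follows`.
  edgePot e x := if ∀ i k : e, i ≤ k → Agree (I.level i) (x i).1.2 (x k).1.2 then θ else 0

theorem edge_injective (n : ℕ) :
    Function.Injective fun j : Fin n => ({j.castSucc, j.succ} : Finset (Fin (n + 1))) := by
  intro j k h
  beta_reduce at h
  have h₁ : j.castSucc ∈ ({k.castSucc, k.succ} : Finset (Fin (n + 1))) := by
    have : j.castSucc ∈ ({j.castSucc, j.succ} : Finset (Fin (n + 1))) := by simp
    exact h ▸ this
  have h₂ : j.succ ∈ ({k.castSucc, k.succ} : Finset (Fin (n + 1))) := by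
    have : j.succ ∈ ({j.castSucc, j.succ} : Finset (Fin (n + 1))) := by simp
    exact h ▸ this
  simp only [Finset.mem_insert, Finset.mem_singleton, Fin.ext_iff, Fin.val_castSucc,
    Fin.val_succ] at h₁ h₂
  exact Fin.ext (by omega)

open Classical in
theorem chain_edgePot (θ : ℝ) (u : I.Arrivals) (j : Fin I.N) :
    (I.chain θ).edgePot {j.castSucc, j.succ} (fun i => u i) = if Follows u j then θ else 0 := by
  refine if_congr ⟨fun h => ?_, fun h => ?_⟩ rfl rfl
  · exact h ⟨j.castSucc, by simp⟩ ⟨j.succ, by simp⟩ (Fin.castSucc_le_succ j)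
  · rintro ⟨i, hi⟩ ⟨k, hk⟩ hik
    simp only [Finset.mem_insert, Finset.mem_singleton] at hi hk
    rcases hi with rfl | rfl <;> rcases hk with rfl | rfl
    · exact Agree.refl _ _
    · exact h
    · exact absurd hik (not_le.2 (Fin.castSucc_lt_succ (i := j)))
    · exact Agree.refl _ _

open Classical in
theorem chain_weight (θ : ℝ) (u : I.Arrivals) :
    (I.chain θ).weight u = Real.exp (∑ j, if Follows u j then θ else 0) := by
  unfold MRF.weight
  have h₁ : (I.chain θ).edges = Finset.univ.image fun j : Fin I.N => {j.castSucc, j.succ} := rfl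
  rw [h₁, Finset.sum_image fun _ _ _ _ h => edge_injective _ h]
  simp only [chain_edgePot]
  simp [chain]

theorem chain_weight_path (θ : ℝ) (g : I.Bits) :
    (I.chain θ).weight (path g) = Real.exp (I.N * θ) := by
  classical
  rw [chain_weight]
  simp [follows_path]

theorem weight_pos {n : ℕ} {Ω : Fin n → Type} (X : MRF Ω) (u : (i : Fin n) → Ω i) :
    0 < X.weight u := Real.exp_pos _

/-- A client lies in at most two hyperedges; client 1 lies in two of them once `2 ≤ N`, and a path
attains the bound there. -/
theorem chain_weightedDegree {θ : ℝ} (hθ : 0 ≤ θ) (hN : 2 ≤ I.N) :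
    (I.chain θ).weightedDegree = 2 * θ := by
  classical
  have key : ∀ (i : Fin (I.N + 1)) (u : I.Arrivals),
      ∑ e ∈ (I.chain θ).edges with i ∈ e, (I.chain θ).edgePot e (fun k => u k) =
        ∑ j with i = Fin.castSucc j ∨ i = Fin.succ j, if Follows u j then θ else 0 := by
    intro i u
    have h₁ : (I.chain θ).edges =
      Finset.univ.image fun j : Fin I.N => {j.castSucc, j.succ} := rfl
    rw [h₁, Finset.filter_image, Finset.sum_image fun _ _ _ _ h => edge_injective _ h]
    simp only [chain_edgePot, Finset.mem_insert, Finset.mem_singleton]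
  have hcard : ∀ i : Fin (I.N + 1),
      (Finset.univ.filter fun j : Fin I.N => i = j.castSucc ∨ i = j.succ).card ≤ 2 := by
    intro i
    rw [Finset.filter_or]
    refine (Finset.card_union_le _ _).trans (add_le_add ?_ ?_ : _ ≤ 1 + 1)
    · exact Finset.card_le_one.2 fun a ha b hb => by
        simp only [Finset.mem_filter, Finset.mem_univ, true_and] at ha hb
        exact Fin.castSucc_injective _ (ha.symm.trans hb)
    · exact Finset.card_le_one.2 fun a ha b hb => by
        simp only [Finset.mem_filter, Finset.mem_univ, true_and] at ha hb
        exact Fin.succ_injective _ (ha.symm.trans hb)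
  have hle : ∀ p : Fin (I.N + 1) × I.Arrivals,
      |∑ e ∈ (I.chain θ).edges with p.1 ∈ e, (I.chain θ).edgePot e (fun k => p.2 k)| ≤ 2 * θ := by
    intro p
    have hterm : ∀ j : Fin I.N, 0 ≤ (if Follows p.2 j then θ else 0) ∧
        (if Follows p.2 j then θ else 0) ≤ θ := fun j => by split_ifs <;> simp [hθ]
    rw [key, abs_of_nonneg (Finset.sum_nonneg fun j _ => (hterm j).1)]
    refine (Finset.sum_le_card_nsmul _ _ θ fun j _ => (hterm j).2).trans ?_
    rw [nsmul_eq_mul]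
    exact mul_le_mul_of_nonneg_right (by exact_mod_cast hcard p.1) hθ
  refine le_antisymm (Real.iSup_le hle (by positivity)) ?_
  let a : Fin I.N := ⟨0, by omega⟩
  let b : Fin I.N := ⟨1, by omega⟩
  let p : Fin (I.N + 1) × I.Arrivals := (a.succ, path 0)
  refine le_trans ?_ (le_ciSup (f := fun p : Fin (I.N + 1) × I.Arrivals =>
    |∑ e ∈ (I.chain θ).edges with p.1 ∈ e, (I.chain θ).edgePot e (fun k => p.2 k)|)
    ⟨2 * θ, by rintro _ ⟨p, rfl⟩; exact hle p⟩ p)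
  rw [key]
  simp only [p, follows_path, if_true]
  rw [Finset.sum_const, nsmul_eq_mul, abs_of_nonneg (by positivity)]
  refine mul_le_mul_of_nonneg_right ?_ hθ
  have hab : ({a, b} : Finset (Fin I.N)) ⊆
      Finset.univ.filter fun j : Fin I.N => a.succ = j.castSucc ∨ a.succ = j.succ := by
    intro j hj
    simp only [Finset.mem_insert, Finset.mem_singleton] at hj
    simp only [Finset.mem_filter, Finset.mem_univ, true_and]
    rcases hj with rfl | rfl
    · exact Or.inr rfl
    · exact Or.inl rfl
  have h2 := Finset.card_le_card hab
  rw [Finset.card_pair (by simp [a, b])] at h2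
  exact_mod_cast h2

/-! ### The probability of leaving a path -/

/-- Change the path from the `j`-th transition on. -/
def shift (j : Fin I.N) (s : I.Bits) (u : I.Arrivals) : I.Arrivals := ofBits fun i =>
  bits u i + if i ≤ j.castSucc then 0 else trunc (I.level j.castSucc) s

theorem bits_shift {j : Fin I.N} {s : I.Bits} {u : I.Arrivals} {i : Fin (I.N + 1)} {t : Fin I.h}
    (ht : (t : ℕ) < I.level i) : bits (shift j s u) i t =
      bits u i t + (if i ≤ j.castSucc then 0 else trunc (I.level j.castSucc) s : I.Bits) t :=
  trunc_of_lt _ ht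

theorem shift_injective (j : Fin I.N) (s : I.Bits) : Function.Injective (shift j s) := by
  intro u w h
  refine arrivals_ext fun i t ht => ?_
  have := congrArg (fun u => bits u i t) h
  simp only [bits_shift ht] at this
  exact add_right_cancel this

/-- Both clients of such a transition are translated by the same vector, or neither is. -/
theorem follows_shift_of_ne {j k : Fin I.N} (s : I.Bits) (u : I.Arrivals) (hk : k ≠ j) :
    Follows (shift j s u) k ↔ Follows u k := by
  refine forall_congr' fun t => imp_congr_right fun ht => ?_
  rw [bits_shift ht, bits_shift (ht.trans_le (I.level_mono (Fin.castSucc_le_succ k)))]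
  have : k.castSucc ≤ j.castSucc ↔ k.succ ≤ j.castSucc := by
    simp only [Fin.le_def, Fin.val_castSucc, Fin.val_succ]
    have := Fin.val_ne_of_ne hk
    omega
  simp only [this, add_left_inj]

theorem follows_shift_self (j : Fin I.N) (u : I.Arrivals) :
    Follows (shift j (bits u j.castSucc - bits u j.succ) u) j := by
  intro t ht
  rw [bits_shift ht, bits_shift (ht.trans_le (I.level_mono (Fin.castSucc_le_succ j))),
    if_pos le_rfl, if_neg (not_le.2 (Fin.castSucc_lt_succ (i := j))), trunc_of_lt _ ht]
  simp

theorem chain_weight_shift (θ : ℝ) {j : Fin I.N} {u : I.Arrivals} (hu : ¬ Follows u j) :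
    (I.chain θ).weight u =
      Real.exp (-θ) * (I.chain θ).weight (shift j (bits u j.castSucc - bits u j.succ) u) := by
  classical
  rw [chain_weight, chain_weight, ← Real.exp_add,
    ← Finset.add_sum_erase _ _ (Finset.mem_univ j),
    ← Finset.add_sum_erase _
      (fun k => if Follows (shift j (bits u j.castSucc - bits u j.succ) u) k then θ else 0)
      (Finset.mem_univ j),
    if_neg hu, if_pos (follows_shift_self j u)]
  have : ∀ k ∈ Finset.univ.erase j,
      (if Follows (shift j (bits u j.castSucc - bits u j.succ) u) k then θ else 0) =
        if Follows u k then θ else 0 := fun k hk =>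
    if_congr (follows_shift_of_ne _ u (Finset.ne_of_mem_erase hk)) rfl rfl
  rw [Finset.sum_congr rfl this]
  congr 1
  ring

open Classical in
-- Sort the arrivals by their discrepancy at transition `j`. For each of the 2^h discrepancies,
-- repairing it is an injective translation that gains a factor e^θ.
theorem sum_weight_not_follows_le (θ : ℝ) (j : Fin I.N) :
    ∑ u with ¬ Follows u j, (I.chain θ).weight u ≤
      2 ^ I.h * Real.exp (-θ) * ∑ u, (I.chain θ).weight u := by
  let s : I.Arrivals → I.Bits := fun u => bits u j.castSucc - bits u j.succ
  rw [← Finset.sum_fiberwise_of_maps_to (g := s) (t := Finset.univ)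
    (fun _ _ => Finset.mem_univ _)]
  have : ∀ b ∈ (Finset.univ : Finset I.Bits),
      ∑ u ∈ Finset.univ.filter (fun u : I.Arrivals => ¬ Follows u j) with s u = b,
        (I.chain θ).weight u ≤ Real.exp (-θ) * ∑ u, (I.chain θ).weight u := by
    intro b _
    calc _ = ∑ u ∈ Finset.univ.filter (fun u : I.Arrivals => ¬ Follows u j) with s u = b,
          Real.exp (-θ) * (I.chain θ).weight (shift j b u) := by
            refine Finset.sum_congr rfl fun u hu => ?_
            simp only [Finset.mem_filter, Finset.mem_univ, true_and] at hu
            rw [chain_weight_shift θ hu.1, ← hu.2]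
      _ ≤ ∑ u, Real.exp (-θ) * (I.chain θ).weight (shift j b u) :=
          Finset.sum_le_sum_of_subset_of_nonneg (Finset.subset_univ _) fun u _ _ =>
            mul_nonneg (Real.exp_pos _).le (weight_pos _ _).le
      _ = _ := by
          rw [← Finset.mul_sum]
          congr 1
          exact (Function.Injective.bijective_of_finite (shift_injective j b)).sum_comp _
  refine (Finset.sum_le_card_nsmul _ _ _ this).trans (le_of_eq ?_)
  rw [nsmul_eq_mul]
  simp [mul_assoc]

open Classical in
theorem sum_weight_not_path_le (θ : ℝ) :
    ∑ u with ¬ ∀ j, Follows u j, (I.chain θ).weight u ≤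
      I.N * (2 ^ I.h * Real.exp (-θ)) * ∑ u, (I.chain θ).weight u := by
  calc _ ≤ ∑ j, ∑ u with ¬ Follows u j, (I.chain θ).weight u := by
        simp only [Finset.sum_filter]
        rw [Finset.sum_comm]
        refine Finset.sum_le_sum fun u _ => ?_
        have hnn : ∀ j ∈ (Finset.univ : Finset (Fin I.N)),
            0 ≤ if ¬ Follows u j then (I.chain θ).weight u else 0 := fun j _ => by
          split_ifs
          exacts [le_rfl, (weight_pos _ _).le]
        split_ifs with hu
        · exact Finset.sum_nonneg hnn
        · obtain ⟨j, hj⟩ := not_forall.1 hu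
          exact (if_pos (c := ¬ Follows u j) hj).ge.trans
            (Finset.single_le_sum hnn (Finset.mem_univ j))
    _ ≤ ∑ _j : Fin I.N, 2 ^ I.h * Real.exp (-θ) * ∑ u, (I.chain θ).weight u :=
        Finset.sum_le_sum fun j _ => sum_weight_not_follows_le θ j
    _ = _ := by
        rw [Finset.sum_const, nsmul_eq_mul]
        simp [mul_assoc]

/-- The probability that the arrivals leave a path is at most `N 2^h e^{-θ}`. -/
theorem one_sub_le_sum_weight_path (θ : ℝ) :
    (1 - I.N * (2 ^ I.h * Real.exp (-θ))) * ∑ u, (I.chain θ).weight u ≤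
      ∑ g : I.Bits, (I.chain θ).weight (path g) := by
  classical
  rw [← sum_follows, sub_mul, one_mul, sub_le_iff_le_add]
  rw [← Finset.sum_filter_add_sum_filter_not Finset.univ (fun u : I.Arrivals => ∀ j, Follows u j)]
  refine add_le_add le_rfl ((sum_weight_not_path_le θ).trans (le_of_eq ?_))
  rw [← Finset.sum_filter_add_sum_filter_not Finset.univ (fun u : I.Arrivals => ∀ j, Follows u j)]

theorem sum_weight_pos (θ : ℝ) : 0 < ∑ u, (I.chain θ).weight u :=
  Finset.sum_pos (fun _ _ => weight_pos _ _) ⟨path 0, Finset.mem_univ _⟩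

theorem chain_expect_eq (θ : ℝ) (F : I.Arrivals → ℝ) :
    (I.chain θ).expect F = (∑ u, (I.chain θ).weight u * F u) / ∑ u, (I.chain θ).weight u := by
  unfold MRF.expect MRF.prob
  rw [Finset.sum_div]
  exact Finset.sum_congr rfl fun u _ => div_mul_eq_mul_div _ _ _

/-- All paths have weight e^{Nθ}, so conditioned on following a path the distribution is uniform. -/
theorem le_chain_expect {θ : ℝ} {F : I.Arrivals → ℝ} (hF : ∀ u, 0 ≤ F u) {K : ℝ} (hK : 0 ≤ K)
    (hp : 2 ^ I.h * K ≤ ∑ g : I.Bits, F (path g)) :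
    (1 - I.N * (2 ^ I.h * Real.exp (-θ))) * K ≤ (I.chain θ).expect F := by
  classical
  rw [chain_expect_eq, le_div_iff₀ (sum_weight_pos θ)]
  calc _ = (1 - I.N * (2 ^ I.h * Real.exp (-θ))) * (∑ u, (I.chain θ).weight u) * K := by ring
    _ ≤ (∑ g : I.Bits, (I.chain θ).weight (path g)) * K :=
        mul_le_mul_of_nonneg_right (one_sub_le_sum_weight_path θ) hK
    _ = Real.exp (I.N * θ) * (2 ^ I.h * K) := by
        simp only [chain_weight_path]
        rw [Finset.sum_const, nsmul_eq_mul]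
        simp
        ring
    _ ≤ Real.exp (I.N * θ) * ∑ g : I.Bits, F (path g) :=
        mul_le_mul_of_nonneg_left hp (Real.exp_pos _).le
    _ = ∑ u with ∀ j, Follows u j, (I.chain θ).weight u * F u := by
        rw [sum_follows, Finset.mul_sum]
        simp only [chain_weight_path]
    _ ≤ _ := Finset.sum_le_sum_of_subset_of_nonneg (Finset.filter_subset _ _) fun u _ _ =>
        mul_nonneg (weight_pos _ _).le (hF u)

theorem chain_expect_le {θ : ℝ} {F : I.Arrivals → ℝ} {K L : ℝ} (hK : 0 ≤ K) (hL : 0 ≤ L)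
    (hp : ∀ g : I.Bits, F (path g) ≤ K) (hF : ∀ u, F u ≤ L) :
    (I.chain θ).expect F ≤ K + I.N * (2 ^ I.h * Real.exp (-θ)) * L := by
  classical
  rw [chain_expect_eq, div_le_iff₀ (sum_weight_pos θ),
    ← Finset.sum_filter_add_sum_filter_not Finset.univ (fun u : I.Arrivals => ∀ j, Follows u j),
    add_mul]
  refine add_le_add ?_ ?_
  · calc _ ≤ ∑ u with ∀ j, Follows u j, (I.chain θ).weight u * K := by
          refine Finset.sum_le_sum fun u hu => mul_le_mul_of_nonneg_left ?_ (weight_pos _ _).le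
          rw [eq_path_of_follows (Finset.mem_filter.1 hu).2]
          exact hp _
      _ ≤ ∑ u, (I.chain θ).weight u * K :=
          Finset.sum_le_sum_of_subset_of_nonneg (Finset.filter_subset _ _) fun u _ _ =>
            mul_nonneg (weight_pos _ _).le hK
      _ = _ := by rw [← Finset.sum_mul, mul_comm]
  · calc _ ≤ ∑ u with ¬ ∀ j, Follows u j, (I.chain θ).weight u * L :=
          Finset.sum_le_sum fun u _ => mul_le_mul_of_nonneg_left (hF u) (weight_pos _ _).le
      _ = (∑ u with ¬ ∀ j, Follows u j, (I.chain θ).weight u) * L := by rw [Finset.sum_mul]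
      _ ≤ _ := mul_le_mul_of_nonneg_right (sum_weight_not_path_le θ) hL
      _ = _ := by ring

end HardTree

/-! ### Bounds on facility location costs -/

section FacilityLocation

variable {M : Type} [DecidableEq M] [MetricSpace M] {c : M → ℝ≥0}

theorem facilityLocation_cost (S : Finset (M ⊕ (M × M))) :
    (facilityLocation M c).cost S = ∑ e ∈ S, elementCost c e := rfl

theorem CoverageProblem.opt_le {V E : Type} [DecidableEq V] [DecidableEq E]
    (P : CoverageProblem V E) {n : ℕ} {v : Fin n → V} {S : Finset E}
    (hS : S ∈ P.feasible (Finset.univ.image v)) : P.opt v ≤ P.cost S :=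
  ciInf_le (f := fun S : P.feasible (Finset.univ.image v) => P.cost S)
    ⟨0, by rintro _ ⟨S, rfl⟩; exact P.cost_nonneg S⟩ ⟨S, hS⟩

theorem OnlineAlgorithm.opt_le_cost {V E : Type} [DecidableEq V] [DecidableEq E]
    {P : CoverageProblem V E} {n : ℕ} (A : OnlineAlgorithm P (n + 1)) (v : Fin (n + 1) → V) :
    P.opt v ≤ A.cost v := by
  refine P.opt_le ?_
  have h := A.feasible v (Fin.last n)
  have : Finset.Iic (Fin.last n) = Finset.univ := Finset.Iic_top
  rwa [this] at h

theorem openCost_le_opt {f : ℝ≥0} {n : ℕ} (v : Fin (n + 1) → M) :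
    (f : ℝ) ≤ (facilityLocation M fun _ => f).opt v := by
  -- A real infimum over an empty family would be 0.
  have : Nonempty ((facilityLocation M fun _ => f).feasible (Finset.univ.image v)) := by
    refine ⟨Finset.univ.image (fun j => Sum.inl (v j)) ∪
      Finset.univ.image (fun j => Sum.inr (v j, v j)), ?_⟩
    intro x hx
    obtain ⟨j, -, rfl⟩ := Finset.mem_image.1 hx
    exact ⟨v j, by simp, by simp⟩
  refine le_ciInf fun S => ?_
  obtain ⟨x, hx, -⟩ := S.2 (v 0) (Finset.mem_image_of_mem _ (Finset.mem_univ _))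
  exact Finset.single_le_sum (f := elementCost fun _ => f)
    (fun e _ => elementCost_nonneg _ e) hx

theorem opt_le_openCost_add_sum_dist {f : ℝ≥0} {n : ℕ} (v : Fin n → M) (x : M) :
    (facilityLocation M fun _ => f).opt v ≤ f + ∑ j, dist x (v j) := by
  refine (CoverageProblem.opt_le _ (S := {Sum.inl x} ∪
    Finset.univ.image (fun j => Sum.inr (x, v j))) ?_).trans ?_
  · intro y hy
    obtain ⟨j, -, rfl⟩ := Finset.mem_image.1 hy
    exact ⟨x, by simp, by simp⟩
  · refine (CoverageProblem.cost_union_le _ _ _).trans (add_le_add ?_ ?_)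
    · rw [facilityLocation_cost, Finset.sum_singleton]
      exact le_rfl
    · rw [facilityLocation_cost]
      exact Finset.sum_image_le_of_nonneg fun e _ => elementCost_nonneg _ e

theorem opt_le_card_mul_openCost {f : ℝ≥0} {n : ℕ} (v : Fin n → M) :
    (facilityLocation M fun _ => f).opt v ≤ n * f := by
  refine (CoverageProblem.opt_le _ (S := Finset.univ.image (fun j => Sum.inl (v j)) ∪
    Finset.univ.image (fun j => Sum.inr (v j, v j))) ?_).trans ?_
  · intro y hy
    obtain ⟨j, -, rfl⟩ := Finset.mem_image.1 hy
    exact ⟨v j, by simp, by simp⟩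
  · refine (CoverageProblem.cost_union_le _ _ _).trans ?_
    rw [← add_zero ((n : ℝ) * f)]
    refine add_le_add ?_ ?_
    · rw [facilityLocation_cost]
      refine (Finset.sum_image_le_of_nonneg fun e _ => elementCost_nonneg _ e).trans (le_of_eq ?_)
      simp [elementCost]
    · rw [facilityLocation_cost]
      refine (Finset.sum_image_le_of_nonneg fun e _ => elementCost_nonneg _ e).trans (le_of_eq ?_)
      simp [elementCost]

/-- Injectivity makes the connections of different clients different elements, so none is counted
twice. -/
theorem le_facilityLocation_cost [Fintype M] {f : ℝ≥0} {n : ℕ} {v : Fin n → M}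
    (hv : Function.Injective v) (S : Finset (M ⊕ (M × M))) :
    f * ((Finset.univ.filter fun x => Sum.inl x ∈ S).card : ℝ) +
        ∑ j, ∑ x, (if Sum.inr (x, v j) ∈ S then dist x (v j) else 0) ≤
      (facilityLocation M fun _ => f).cost S := by
  rw [facilityLocation_cost, ← Finset.filter_univ_mem S, Finset.sum_filter,
    Fintype.sum_sum_type, Fintype.sum_prod_type_right, Finset.filter_univ_mem]
  refine add_le_add ?_ ?_
  · rw [← Finset.sum_filter]
    simp [elementCost, mul_comm]
  · rw [← Finset.sum_image (s := Finset.univ) (g := v)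
      (f := fun y => ∑ x, if Sum.inr (x, y) ∈ S then dist x y else 0) fun _ _ _ _ h => hv h]
    refine Finset.sum_le_sum_of_subset_of_nonneg (Finset.subset_univ _) fun y _ _ =>
      Finset.sum_nonneg fun x _ => ?_
    split_ifs
    exacts [elementCost_nonneg (fun _ => f) (Sum.inr (x, y)), le_rfl]

end FacilityLocation

theorem sum_card_le_card_of_disjoint {ι α : Type*} [Fintype ι] [DecidableEq α]
    {s : ι → Finset α} {F : Finset α} (hs : ∀ i, s i ⊆ F)
    (hd : ∀ i j, i ≠ j → Disjoint (s i) (s j)) : ∑ i, (s i).card ≤ F.card := by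
  rw [← Finset.card_biUnion fun i _ j _ => hd i j]
  exact Finset.card_le_card (Finset.biUnion_subset.2 fun i _ => hs i)

/-! ### Deterministic algorithms on a random path -/

namespace HardTree

variable {I : HardTree}

/-- The points at which the clients appear. -/
abbrev clients (u : I.Arrivals) : Fin (I.N + 1) → I.Pt := fun i => u i

theorem clients_path (g : I.Bits) (j : Fin (I.N + 1)) :
    clients (path g) j = ((j, trunc (I.level j) g) : I.Pt) := rfl

theorem clients_injective (u : I.Arrivals) : Function.Injective (clients u) := by
  intro i j h
  have h' : (u i : I.Pt) = u j := h
  rw [coe_arrival, coe_arrival] at h'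
  exact congrArg Prod.fst h'

/-- The leaf at the end of the path `g`. -/
def leaf (g : I.Bits) : I.Pt := (Fin.last I.N, g)

theorem le_meet_leaf_iff {x : I.Pt} {g : I.Bits} {k : ℕ} :
    k ≤ meet x (leaf g) ↔ k ≤ I.level x.1 ∧ Agree k x.2 g := by
  rw [le_meet_iff]
  refine ⟨fun h => ⟨h.1, h.2.2⟩, fun h => ⟨h.1, ?_, h.2⟩⟩
  change k ≤ I.level (Fin.last I.N)
  rw [I.level_last]
  exact h.1.trans (I.level_le _)

theorem meet_client_le {x : I.Pt} {g : I.Bits} {j : Fin (I.N + 1)} :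
    meet x (clients (path g) j) ≤ meet x (leaf g) := by
  have h := le_meet_iff.1 (le_refl (meet x (clients (path g) j)))
  exact le_meet_leaf_iff.2 ⟨h.1, h.2.2.trans ((agree_trunc _ g).mono h.2.1)⟩

theorem meet_client_leaf {g : I.Bits} {j : Fin (I.N + 1)} :
    I.level j ≤ meet (clients (path g) j) (leaf g) :=
  le_meet_leaf_iff.2 ⟨le_rfl, agree_trunc _ g⟩

theorem opt_path_le (f : ℝ≥0) (g : I.Bits) :
    (facilityLocation I.Pt fun _ => f).opt (clients (path g)) ≤
      f + ∑ j, I.scale (I.level j) := by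
  refine (opt_le_openCost_add_sum_dist _ (leaf g)).trans (add_le_add le_rfl ?_)
  refine Finset.sum_le_sum fun j _ => ?_
  rw [dist_comm]
  exact (dist_le_scale _ _).trans (I.scale_anti meet_client_leaf)

section LowerBound

variable {f : ℝ≥0} (A : OnlineAlgorithm (facilityLocation I.Pt fun _ => f) (I.N + 1))

/-- What the algorithm has bought when the clients of level below `i` have arrived. -/
def bought (g : I.Bits) (i : ℕ) : Finset (I.Pt ⊕ (I.Pt × I.Pt)) :=
  (Finset.univ.filter fun j => I.level j < i).biUnion (A.select (clients (path g)))

/-- The facilities opened when the clients of level below `i` have arrived. -/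
def opened (g : I.Bits) (i : ℕ) : Finset I.Pt :=
  Finset.univ.filter fun x => Sum.inl x ∈ bought A g i

/-- Everything that the algorithm buys. -/
def total (g : I.Bits) : Finset (I.Pt ⊕ (I.Pt × I.Pt)) :=
  Finset.univ.biUnion (A.select (clients (path g)))

theorem bought_mono (g : I.Bits) : Monotone (bought A g) := fun _ _ h =>
  Finset.biUnion_subset_biUnion_of_subset_left _
    (Finset.monotone_filter_right _ fun _ _ hj => lt_of_lt_of_le hj h)

theorem bought_subset_total (g : I.Bits) (i : ℕ) : bought A g i ⊆ total A g :=
  Finset.biUnion_subset_biUnion_of_subset_left _ (Finset.subset_univ _)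

theorem mem_opened {g : I.Bits} {i : ℕ} {x : I.Pt} :
    x ∈ opened A g i ↔ Sum.inl x ∈ bought A g i := by simp [opened]

theorem opened_mono (g : I.Bits) : Monotone (opened A g) := fun _ _ h _ hx =>
  (mem_opened A).2 (bought_mono A g h ((mem_opened A).1 hx))

theorem opened_subset (g : I.Bits) (i : ℕ) :
    opened A g i ⊆ Finset.univ.filter fun x => Sum.inl x ∈ total A g := fun _ hx =>
  Finset.mem_filter.2 ⟨Finset.mem_univ _, bought_subset_total A g i ((mem_opened A).1 hx)⟩

/-- Causality: clients of level at most `i` depend only on the first `i` bits. -/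
theorem opened_congr {g g' : I.Bits} {i : ℕ} (h : Agree i g g') :
    opened A g (i + 1) = opened A g' (i + 1) := by
  have : bought A g (i + 1) = bought A g' (i + 1) := by
    refine Finset.biUnion_congr rfl fun j hj => A.causal _ _ j fun k hk => ?_
    have hlt := (Finset.mem_filter.1 hj).2
    have hle := I.level_mono hk
    rw [clients_path, clients_path, trunc_eq_iff.2 (h.mono (by omega))]
  unfold opened
  rw [this]

/-- The facilities that leave the subtree of the path in its `i`-th step. -/
noncomputable def lost (g : I.Bits) (i : Fin I.h) : Finset I.Pt :=
  (opened A g (i + 1)).filter fun x => meet x (leaf g) = i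

/-- The facilities opened while the clients of level `i + 1` arrive. -/
def fresh (g : I.Bits) (i : Fin I.h) : Finset I.Pt :=
  opened A g (i + 2) \ opened A g (i + 1)

/-- The cost of the connections of the `j`-th client. -/
noncomputable def linkCost (g : I.Bits) (j : Fin (I.N + 1)) : ℝ :=
  ∑ x, if Sum.inr (x, clients (path g) j) ∈ total A g then dist x (clients (path g) j) else 0

theorem linkCost_nonneg (g : I.Bits) (j : Fin (I.N + 1)) : 0 ≤ linkCost A g j :=
  Finset.sum_nonneg fun x _ => by
    split_ifs
    exacts [dist_nonneg, le_rfl]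

/-- What the algorithm loses in the `i`-th step of the path. -/
noncomputable def charge (g : I.Bits) (i : Fin I.h) : ℝ :=
  f * (lost A g i).card + (f * (fresh A g i).card + ∑ j with I.level j = i + 1, linkCost A g j)

theorem links_nonneg (g : I.Bits) (i : Fin I.h) :
    0 ≤ ∑ j with I.level j = i + 1, linkCost A g j :=
  Finset.sum_nonneg fun j _ => linkCost_nonneg A g j

theorem charge_nonneg (g : I.Bits) (i : Fin I.h) : 0 ≤ charge A g i := by
  have := links_nonneg A g i
  unfold charge
  positivity

theorem le_charge_of_lost {g : I.Bits} {i : Fin I.h} (h : (lost A g i).Nonempty) :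
    (f : ℝ) ≤ charge A g i := by
  have h₁ : (1 : ℝ) ≤ (lost A g i).card := by exact_mod_cast h.card_pos
  have h₂ := links_nonneg A g i
  have h₃ : (f : ℝ) * 1 ≤ f * (lost A g i).card := mul_le_mul_of_nonneg_left h₁ f.2
  unfold charge
  have : 0 ≤ (f : ℝ) * (fresh A g i).card := by positivity
  linarith

/-- Either the next batch gets a new facility in the subtree just entered, or all its clients
connect to outside it at distance at least `scale i`, which `hf` makes as expensive as a facility.
-/
theorem le_charge_of_forall {g : I.Bits} {i : Fin I.h}
    (hf : (f : ℝ) ≤ (Finset.univ.filter fun j => I.level j = i + 1).card * I.scale i)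
    (h : ∀ x ∈ opened A g (i + 1), meet x (leaf g) ≤ i) : (f : ℝ) ≤ charge A g i := by
  have hl : 0 ≤ (f : ℝ) * (lost A g i).card := by positivity
  unfold charge
  by_cases hnew : ∃ x ∈ opened A g (i + 2), (i : ℕ) + 1 ≤ meet x (leaf g)
  · obtain ⟨x, hx, hxi⟩ := hnew
    have hmem : x ∈ fresh A g i :=
      Finset.mem_sdiff.2 ⟨hx, fun hx' => absurd (h x hx') (by omega)⟩
    have h₁ : (1 : ℝ) ≤ (fresh A g i).card := by exact_mod_cast Finset.card_pos.2 ⟨x, hmem⟩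
    have h₂ := links_nonneg A g i
    have h₃ : (f : ℝ) * 1 ≤ f * (fresh A g i).card := mul_le_mul_of_nonneg_left h₁ f.2
    linarith
  · have hlink : ∀ j ∈ Finset.univ.filter fun j => I.level j = i + 1,
        I.scale i ≤ linkCost A g j := by
      intro j hj
      have hj := (Finset.mem_filter.1 hj).2
      obtain ⟨x, hx, hxj⟩ := A.feasible (clients (path g)) j (clients (path g) j)
        (Finset.mem_image_of_mem _ (Finset.mem_Iic.2 le_rfl))
      have hsub : (Finset.Iic j).biUnion (A.select (clients (path g))) ⊆ bought A g (i + 2) := by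
        refine Finset.biUnion_subset_biUnion_of_subset_left _ fun k hk => ?_
        have := I.level_mono (Finset.mem_Iic.1 hk)
        exact Finset.mem_filter.2 ⟨Finset.mem_univ _, by omega⟩
      have hx' : meet x (leaf g) ≤ i := by
        by_contra hlt
        exact hnew ⟨x, (mem_opened A).2 (hsub hx), by omega⟩
      have hne : x ≠ clients (path g) j := by
        rintro rfl
        have := meet_client_leaf (g := g) (j := j)
        omega
      have hdist : I.scale i ≤ dist x (clients (path g) j) := by
        rw [dist_def, if_neg hne]
        exact I.scale_anti (meet_client_le.trans hx')
      have := Finset.single_le_sum (f := fun x => if Sum.inr (x, clients (path g) j) ∈ total A g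
        then dist x (clients (path g) j) else 0) (s := Finset.univ)
        (fun x _ => by
          split_ifs
          exacts [dist_nonneg, le_rfl]) (Finset.mem_univ x)
      rw [if_pos (bought_subset_total A g _ (hsub hxj))] at this
      exact hdist.trans this
    have h₁ := Finset.card_nsmul_le_sum _ _ _ hlink
    rw [nsmul_eq_mul] at h₁
    have : 0 ≤ (f : ℝ) * (fresh A g i).card := by positivity
    linarith

/-- A facility already open in the subtree entered by `g` is lost on the path with bit `i` flipped;
if there is none, `g` itself pays. -/
theorem le_charge_add_charge {i : Fin I.h}
    (hf : (f : ℝ) ≤ (Finset.univ.filter fun j => I.level j = i + 1).card * I.scale i)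
    (g : I.Bits) : (f : ℝ) ≤ charge A g i + charge A (g + Pi.single i 1) i := by
  have hagree : Agree i g (g + Pi.single i 1) := by
    intro t ht
    have : t ≠ i := fun h => absurd ht (h ▸ lt_irrefl _)
    simp [this]
  have h₁ := charge_nonneg A g i
  have h₂ := charge_nonneg A (g + Pi.single i 1) i
  by_cases hB : ∃ x ∈ opened A g (i + 1), (i : ℕ) + 1 ≤ meet x (leaf g)
  · obtain ⟨x, hx, hxi⟩ := hB
    have hxg := le_meet_leaf_iff.1 hxi
    have hle : (i : ℕ) ≤ meet x (leaf (g + Pi.single i 1)) :=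
      le_meet_leaf_iff.2 ⟨by omega, (hxg.2.mono (Nat.le_succ _)).trans hagree⟩
    have hge : meet x (leaf (g + Pi.single i 1)) ≤ i := by
      by_contra hlt
      have h₃ := (le_meet_leaf_iff.1 (Nat.succ_le_of_lt (not_le.1 hlt))).2 i (Nat.lt_succ_self _)
      have h₄ := hxg.2 i (Nat.lt_succ_self _)
      rw [h₄] at h₃
      simp at h₃
    have := le_charge_of_lost A (g := g + Pi.single i 1) (i := i)
      ⟨x, Finset.mem_filter.2 ⟨opened_congr A hagree ▸ hx, le_antisymm hge hle⟩⟩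
    linarith
  · have := le_charge_of_forall A hf (g := g) fun x hx => by
      by_contra hlt
      exact hB ⟨x, hx, by omega⟩
    linarith

/-- A facility is lost only at the depth of its meet with the leaf, and is new in only one batch; so
opening costs count at most twice and connections once. -/
theorem sum_charge_le (g : I.Bits) : ∑ i, charge A g i ≤ 2 * A.cost (clients (path g)) := by
  have hcost := le_facilityLocation_cost (f := f) (clients_injective (path g)) (total A g)
  set F : Finset I.Pt := Finset.univ.filter fun x => Sum.inl x ∈ total A g
  have hlost : ∑ i, (lost A g i).card ≤ F.card := by
    refine sum_card_le_card_of_disjoint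
      (fun i => (Finset.filter_subset _ _).trans (opened_subset A g _)) fun i j hij => ?_
    rw [Finset.disjoint_left]
    intro x hi hj
    exact hij (Fin.ext ((Finset.mem_filter.1 hi).2.symm.trans (Finset.mem_filter.1 hj).2))
  have hdisj : ∀ i j : Fin I.h, i < j → Disjoint (fresh A g i) (fresh A g j) := by
    intro i j hij
    rw [Finset.disjoint_left]
    intro x hi hj
    have : (i : ℕ) < j := hij
    exact (Finset.mem_sdiff.1 hj).2
      (opened_mono A g (by omega : (i : ℕ) + 2 ≤ j + 1) (Finset.mem_sdiff.1 hi).1)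
  have hfresh : ∑ i, (fresh A g i).card ≤ F.card :=
    sum_card_le_card_of_disjoint
      (fun i => Finset.sdiff_subset.trans (opened_subset A g _)) fun i j hij =>
        (lt_or_gt_of_ne hij).elim (hdisj i j) fun h => (hdisj j i h).symm
  have hlink : ∑ i : Fin I.h, ∑ j with I.level j = i + 1, linkCost A g j ≤
      ∑ j, linkCost A g j := by
    rw [← Finset.sum_biUnion]
    · exact Finset.sum_le_sum_of_subset_of_nonneg (Finset.subset_univ _) fun j _ _ =>
        linkCost_nonneg A g j
    · intro i _ k _ hik
      change Disjoint _ _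
      rw [Finset.disjoint_left]
      intro j hi hk
      have h₁ := (Finset.mem_filter.1 hi).2
      have h₂ := (Finset.mem_filter.1 hk).2
      exact hik (Fin.ext (by omega))
  have hnn : 0 ≤ ∑ j, linkCost A g j := Finset.sum_nonneg fun j _ => linkCost_nonneg A g j
  have hlost' : (f : ℝ) * ∑ i, ((lost A g i).card : ℝ) ≤ f * F.card :=
    mul_le_mul_of_nonneg_left (by exact_mod_cast hlost) f.2
  have hfresh' : (f : ℝ) * ∑ i, ((fresh A g i).card : ℝ) ≤ f * F.card :=
    mul_le_mul_of_nonneg_left (by exact_mod_cast hfresh) f.2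
  have hcost' : f * (F.card : ℝ) + ∑ j, linkCost A g j ≤ A.cost (clients (path g)) := hcost
  simp only [charge, Finset.sum_add_distrib, ← Finset.mul_sum]
  linarith

/-- On a uniformly random path every deterministic online algorithm pays at least `h f / 4`. -/
theorem le_sum_cost_path
    (hf : ∀ i : Fin I.h,
      (f : ℝ) ≤ (Finset.univ.filter fun j => I.level j = i + 1).card * I.scale i) :
    2 ^ I.h * (I.h * f / 4) ≤ ∑ g : I.Bits, A.cost (clients (path g)) := by
  have hstep : ∀ i : Fin I.h, 2 ^ I.h * (f : ℝ) ≤ 2 * ∑ g, charge A g i := by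
    intro i
    -- Flipping bit `i` permutes the paths.
    have h₁ : ∑ g, charge A (g + Pi.single i 1) i = ∑ g, charge A g i :=
      Equiv.sum_comp (Equiv.addRight (Pi.single i 1)) fun g => charge A g i
    have h₂ := Finset.card_nsmul_le_sum Finset.univ _ _ fun g _ =>
      le_charge_add_charge A (hf i) g
    rw [Finset.sum_add_distrib, h₁, nsmul_eq_mul] at h₂
    simp only [Finset.card_univ, Fintype.card_fun, ZMod.card, Fintype.card_fin,
      Nat.cast_pow, Nat.cast_ofNat] at h₂
    linarith
  have h₁ : ∑ i : Fin I.h, 2 ^ I.h * (f : ℝ) ≤ ∑ i, 2 * ∑ g, charge A g i :=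
    Finset.sum_le_sum fun i _ => hstep i
  have h₂ : ∑ g, ∑ i, charge A g i ≤ ∑ g : I.Bits, 2 * A.cost (clients (path g)) :=
    Finset.sum_le_sum fun g _ => sum_charge_le A g
  simp only [← Finset.mul_sum] at h₁
  rw [Finset.sum_comm, Finset.sum_const, nsmul_eq_mul, Finset.card_univ, Fintype.card_fin] at h₁
  rw [← Finset.mul_sum] at h₂
  linarith

end LowerBound

end HardTree

/-! ### Integrability for randomized algorithms -/

theorem OnlineAlgorithm.cost_nonneg {V E : Type} [DecidableEq V] [DecidableEq E]
    {P : CoverageProblem V E} {n : ℕ} (A : OnlineAlgorithm P n) (v : Fin n → V) : 0 ≤ A.cost v :=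
  P.cost_nonneg _

theorem OnlineAlgorithm.integrable_cost {V E : Type} [DecidableEq V] [DecidableEq E] [Finite E]
    {P : CoverageProblem V E} {n : ℕ} {R : Type} [MeasurableSpace R] (μ : Measure R)
    [IsFiniteMeasure μ] {A : R → OnlineAlgorithm P n}
    (hA : ∀ (v : Fin n → V) (i : Fin n) (S : Finset E), MeasurableSet {r | (A r).select v i = S})
    (v : Fin n → V) : Integrable (fun r => (A r).cost v) μ := by
  have := Fintype.ofFinite E
  let : MeasurableSpace (Finset E) := ⊤
  have h₁ : Measurable fun r => (A r).select v :=
    measurable_pi_iff.2 fun i => measurable_to_countable' fun S => hA v i S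
  have h₂ : Measurable fun s : Fin n → Finset E => P.cost (Finset.univ.biUnion s) :=
    Measurable.of_discrete
  refine Integrable.of_bound (h₂.comp h₁).aestronglyMeasurable (P.cost Finset.univ) ?_
  refine Filter.Eventually.of_forall fun r => ?_
  rw [Real.norm_of_nonneg ((A r).cost_nonneg v)]
  exact P.cost_mono (Finset.subset_univ _)

/-! ### The geometric instance -/

namespace HardTree

variable (h : ℕ)

theorem log_pow_pred (hh : 1 ≤ h) : Nat.log (h + 1) ((h + 1) ^ (h + 1) - 1) = h := by
  have h₁ : (h + 1) ^ h < (h + 1) ^ (h + 1) := Nat.pow_lt_pow_right (by omega) (Nat.lt_succ_self _)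
  exact Nat.log_eq_of_pow_le_of_lt_pow (by omega) (by omega)

/-- The tree of depth `h` with `(h + 1) ^ (h + 1)` clients, in which the distances decrease by a
factor of `h + 1` from one level to the next, while the numbers of clients increase by it. -/
noncomputable def geometric (hh : 1 ≤ h) : HardTree where
  N := (h + 1) ^ (h + 1) - 1
  h := h
  -- Since `Nat.log _ 0 = 0`, client 0 joins clients 1 to h at the root.
  level j := Nat.log (h + 1) j
  scale i := 1 / ((h + 1 : ℕ) : ℝ) ^ i
  level_mono _ _ hij := Nat.log_mono_right hij
  level_last := log_pow_pred h hh
  scale_pos i := by positivity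
  scale_anti i j hij := one_div_le_one_div_of_le (by positivity)
    (pow_le_pow_right₀ (by exact_mod_cast Nat.succ_le_succ (Nat.zero_le h)) hij)

variable {h} (hh : 1 ≤ h)

theorem geometric_N_add_one : (geometric h hh).N + 1 = (h + 1) ^ (h + 1) :=
  Nat.sub_add_cancel (Nat.one_le_pow _ _ (Nat.succ_pos _))

theorem two_le_geometric_N : 2 ≤ (geometric h hh).N := by
  have h₁ := geometric_N_add_one hh
  have h₂ : 2 ^ 2 ≤ (h + 1) ^ (h + 1) :=
    (Nat.pow_le_pow_left (by omega) 2).trans (Nat.pow_le_pow_right (by omega) (by omega))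
  omega

/-- Batch `i + 1` has (h + 1)^(i + 2) - (h + 1)^(i + 1) clients; times `scale i` this is h(h + 1),
whence the opening cost. -/
theorem openCost_le_card_mul_scale (i : Fin (geometric h hh).h) :
    (((h + 1) * h : ℕ) : ℝ) ≤ (Finset.univ.filter fun j =>
      (geometric h hh).level j = i + 1).card * (geometric h hh).scale i := by
  have hi : (i : ℕ) < h := i.2
  have hsub : Finset.Ico ((h + 1) ^ ((i : ℕ) + 1)) ((h + 1) ^ ((i : ℕ) + 2)) ⊆
      (Finset.univ.filter fun j => (geometric h hh).level j = i + 1).image Fin.val := by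
    intro k hk
    rw [Finset.mem_Ico] at hk
    have hk' : k < (geometric h hh).N + 1 := by
      rw [geometric_N_add_one]
      exact hk.2.trans_le (Nat.pow_le_pow_right (by omega) (by omega))
    exact Finset.mem_image.2 ⟨⟨k, hk'⟩, Finset.mem_filter.2 ⟨Finset.mem_univ _,
      Nat.log_eq_of_pow_le_of_lt_pow hk.1 hk.2⟩, rfl⟩
  have hcard := (Finset.card_le_card hsub).trans Finset.card_image_le
  rw [Nat.card_Ico] at hcard
  have h₁ : (h + 1) ^ ((i : ℕ) + 2) - (h + 1) ^ ((i : ℕ) + 1) =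
      (h + 1) * h * (h + 1) ^ (i : ℕ) := by
    refine Nat.sub_eq_of_eq_add ?_
    ring
  rw [h₁] at hcard
  have h₂ : (((h + 1) * h : ℕ) : ℝ) * ((h + 1 : ℕ) : ℝ) ^ (i : ℕ) ≤ (Finset.univ.filter fun j =>
      (geometric h hh).level j = i + 1).card := by exact_mod_cast hcard
  change _ ≤ _ * (1 / ((h + 1 : ℕ) : ℝ) ^ (i : ℕ))
  rwa [mul_one_div, le_div_iff₀ (by positivity)]

theorem sum_scale_level_le :
    ∑ j, (geometric h hh).scale ((geometric h hh).level j) ≤ ((h + 1 : ℕ) : ℝ) ^ 2 := by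
  rw [← Finset.sum_fiberwise_of_maps_to (s := Finset.univ) (g := (geometric h hh).level)
    (t := Finset.range (h + 1)) fun j _ =>
      Finset.mem_range.2 (Nat.lt_succ_of_le ((geometric h hh).level_le j))]
  have key : ∀ i ∈ Finset.range (h + 1),
      ∑ j with (geometric h hh).level j = i, (geometric h hh).scale ((geometric h hh).level j) ≤
        ((h + 1 : ℕ) : ℝ) := by
    intro i _
    have hsub : (Finset.univ.filter fun j => (geometric h hh).level j = i).image Fin.val ⊆
        Finset.range ((h + 1) ^ (i + 1)) := by
      intro k hk
      obtain ⟨j, hj, rfl⟩ := Finset.mem_image.1 hk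
      have hj : Nat.log (h + 1) j = i := (Finset.mem_filter.1 hj).2
      exact Finset.mem_range.2 (hj ▸ Nat.lt_pow_succ_log_self (by omega) _)
    have hcard := Finset.card_le_card hsub
    rw [Finset.card_image_of_injective _ Fin.val_injective, Finset.card_range] at hcard
    have hcard' : ((Finset.univ.filter fun j => (geometric h hh).level j = i).card : ℝ) ≤
        ((h + 1 : ℕ) : ℝ) ^ (i + 1) := by exact_mod_cast hcard
    rw [Finset.sum_congr rfl fun j hj => by rw [(Finset.mem_filter.1 hj).2], Finset.sum_const,
      nsmul_eq_mul]
    change _ * (1 / ((h + 1 : ℕ) : ℝ) ^ i) ≤ _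
    rw [mul_one_div, div_le_iff₀ (by positivity), ← pow_succ']
    exact hcard'
  refine (Finset.sum_le_card_nsmul _ _ _ key).trans (le_of_eq ?_)
  rw [nsmul_eq_mul, Finset.card_range, sq]

section Expectation

variable {I : HardTree} {f : ℝ≥0} (θ : ℝ)

theorem expect_mono {F G : I.Arrivals → ℝ} (hFG : ∀ u, F u ≤ G u) :
    (I.chain θ).expect F ≤ (I.chain θ).expect G :=
  Finset.sum_le_sum fun u _ => mul_le_mul_of_nonneg_left (hFG u)
    (div_nonneg (weight_pos _ _).le (sum_weight_pos θ).le)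

theorem expect_const (K : ℝ) : (I.chain θ).expect (fun _ => K) = K := by
  rw [chain_expect_eq, ← Finset.sum_mul, mul_div_cancel_left₀ _ (sum_weight_pos θ).ne']

theorem openCost_le_expect_opt :
    (f : ℝ) ≤ (I.chain θ).expect fun u =>
      (facilityLocation I.Pt fun _ => f).opt (clients u) := by
  rw [← expect_const (I := I) θ (f : ℝ)]
  exact expect_mono θ fun u => openCost_le_opt _

variable {R : Type} [MeasurableSpace R] (μ : Measure R) [IsProbabilityMeasure μ]
  {A : R → OnlineAlgorithm (facilityLocation I.Pt fun _ => f) (I.N + 1)}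

theorem expect_opt_le_expect_cost
    (hA : ∀ (v : Fin (I.N + 1) → I.Pt) (i : Fin (I.N + 1)) (S : Finset (I.Pt ⊕ (I.Pt × I.Pt))),
      MeasurableSet {r | (A r).select v i = S}) :
    (I.chain θ).expect (fun u => (facilityLocation I.Pt fun _ => f).opt (clients u)) ≤
      (I.chain θ).expect fun u => ∫ r, (A r).cost (clients u) ∂μ := by
  refine expect_mono θ fun u => ?_
  have := integral_mono (μ := μ) (integrable_const _)
    (OnlineAlgorithm.integrable_cost μ hA (clients u))
    fun r => (A r).opt_le_cost (clients u)
  simpa using this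

/-- The easy half of Yao's principle: the bound on the average over paths holds for every `r` and is
integrated. -/
theorem le_expect_cost
    (hA : ∀ (v : Fin (I.N + 1) → I.Pt) (i : Fin (I.N + 1)) (S : Finset (I.Pt ⊕ (I.Pt × I.Pt))),
      MeasurableSet {r | (A r).select v i = S})
    (hf : ∀ i : Fin I.h,
      (f : ℝ) ≤ (Finset.univ.filter fun j => I.level j = i + 1).card * I.scale i) :
    (1 - I.N * (2 ^ I.h * Real.exp (-θ))) * (I.h * f / 4) ≤
      (I.chain θ).expect fun u => ∫ r, (A r).cost (clients u) ∂μ := by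
  refine le_chain_expect
    (fun u => integral_nonneg fun r => (A r).cost_nonneg (clients u)) (by positivity) ?_
  have hint := fun g : I.Bits => OnlineAlgorithm.integrable_cost μ hA (clients (path g))
  rw [← integral_finsetSum _ fun g _ => hint g]
  have := integral_mono (μ := μ) (integrable_const _)
    (integrable_finsetSum _ fun g _ => hint g) fun r => le_sum_cost_path (A r) hf
  simpa using this

theorem expect_opt_le {K : ℝ} (hK : ∑ j, I.scale (I.level j) ≤ K) (hK₀ : 0 ≤ K) :
    (I.chain θ).expect (fun u => (facilityLocation I.Pt fun _ => f).opt (clients u)) ≤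
      f + K + I.N * (2 ^ I.h * Real.exp (-θ)) * ((I.N + 1 : ℕ) * f) :=
  chain_expect_le (by positivity) (by positivity)
    (fun g => (opt_path_le f g).trans (add_le_add le_rfl hK))
    fun u => opt_le_card_mul_openCost _

end Expectation

/-- The factor `N + 1` comes from the crude bound on the optimum off the paths; with `N` it accounts
for the 2 in `hθ`. -/
theorem escape_le {θ : ℝ}
    (hθ : 2 * ((h + 1 : ℕ) * Real.log (h + 1 : ℕ)) + (h + 1 : ℕ) * Real.log 2 ≤ θ) :
    (geometric h hh).N * (2 ^ h * Real.exp (-θ)) * ((geometric h hh).N + 1 : ℕ) ≤ 1 := by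
  have hN : ((geometric h hh).N : ℝ) ≤ ((geometric h hh).N + 1 : ℕ) := by
    exact_mod_cast Nat.le_succ _
  have hb : (0 : ℝ) < (h + 1 : ℕ) := by positivity
  have h₁ : (((geometric h hh).N + 1 : ℕ) : ℝ) =
      Real.exp ((h + 1 : ℕ) * Real.log (h + 1 : ℕ)) := by
    rw [geometric_N_add_one, Real.exp_nat_mul, Real.exp_log hb]
    push_cast
    rfl
  have h₂ : (2 : ℝ) ^ h ≤ Real.exp ((h + 1 : ℕ) * Real.log 2) := by
    rw [Real.exp_nat_mul, Real.exp_log two_pos]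
    exact pow_le_pow_right₀ one_le_two (Nat.le_succ h)
  calc _ ≤ (((geometric h hh).N + 1 : ℕ) : ℝ) *
        (Real.exp ((h + 1 : ℕ) * Real.log 2) * Real.exp (-θ)) *
          ((geometric h hh).N + 1 : ℕ) := by gcongr
    _ = Real.exp (2 * ((h + 1 : ℕ) * Real.log (h + 1 : ℕ)) + (h + 1 : ℕ) * Real.log 2 - θ) := by
        rw [h₁, ← Real.exp_add, ← Real.exp_add, ← Real.exp_add]
        congr 1
        ring
    _ ≤ 1 := Real.exp_le_one_iff.2 (by linarith)

theorem geometric_gap (hh₂ : 2 ≤ h) {θ : ℝ}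
    (hθ : 2 * ((h + 1 : ℕ) * Real.log (h + 1 : ℕ)) + (h + 1 : ℕ) * Real.log 2 ≤ θ)
    {R : Type} [MeasurableSpace R] (μ : Measure R) [IsProbabilityMeasure μ]
    {A : R → OnlineAlgorithm (facilityLocation (geometric h hh).Pt
      fun _ => (((h + 1) * h : ℕ) : ℝ≥0)) ((geometric h hh).N + 1)}
    (hA : ∀ v i S, MeasurableSet {r | (A r).select v i = S}) :
    ((h + 1 : ℕ) : ℝ) / 54 * ((geometric h hh).chain θ).expect (fun u =>
        (facilityLocation (geometric h hh).Pt
          fun _ => (((h + 1) * h : ℕ) : ℝ≥0)).opt (clients u)) ≤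
      ((geometric h hh).chain θ).expect fun u => ∫ r, (A r).cost (clients u) ∂μ := by
  have hesc := escape_le hh hθ
  have hN : (2 : ℝ) ≤ ((geometric h hh).N + 1 : ℕ) := by
    exact_mod_cast (two_le_geometric_N hh).trans (Nat.le_succ _)
  have hopt := expect_opt_le (I := geometric h hh) (f := (((h + 1) * h : ℕ) : ℝ≥0)) θ
    (sum_scale_level_le hh) (by positivity)
  have halg := le_expect_cost θ μ hA fun i => by
    simpa using openCost_le_card_mul_scale hh i
  have hdepth : (geometric h hh).h = h := rfl
  rw [hdepth] at hopt halg
  set ε : ℝ := (geometric h hh).N * (2 ^ h * Real.exp (-θ))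
  set n : ℝ := (((geometric h hh).N + 1 : ℕ) : ℝ)
  have hε₀ : 0 ≤ ε := by positivity
  have hε : ε ≤ 1 / 2 := by nlinarith
  have hhr : (2 : ℝ) ≤ h := by exact_mod_cast hh₂
  rw [NNReal.coe_natCast] at hopt halg
  push_cast at hopt halg ⊢
  have h₁ : ε * (n * ((h + 1) * h)) ≤ (h + 1 : ℝ) * h := by
    rw [← mul_assoc]
    exact mul_le_of_le_one_left (by positivity) hesc
  have h₂ : 1 / 2 * (h * ((h + 1) * h) / 4) ≤ (1 - ε) * ((h : ℝ) * ((h + 1) * h) / 4) :=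
    mul_le_mul_of_nonneg_right (by linarith) (by positivity)
  refine le_trans ?_ (h₂.trans halg)
  -- The optimum is at most 2h(h + 1) + (h + 1)^2 ≤ 3(h + 1)^2; the 54 then comes from (h + 1)/h ≤
  -- 3/2 for h ≥ 2.
  have h₃ : ((h : ℝ) + 1) / 54 * (3 * (h + 1) ^ 2) ≤ 1 / 2 * (h * ((h + 1) * h) / 4) := by
    have : 4 * ((h : ℝ) + 1) ^ 2 ≤ 9 * h ^ 2 := by nlinarith
    nlinarith
  refine le_trans (mul_le_mul_of_nonneg_left ?_ (by positivity)) h₃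
  nlinarith

end HardTree

/-! ### Choice of the depth and conclusion -/

theorem exists_depth {Δ : ℝ} (hΔ : 2 ≤ Δ) (hlarge : 18 ≤ Δ / Real.log Δ) :
    ∃ h : ℕ, 2 ≤ h ∧
      2 * ((h + 1 : ℕ) * Real.log (h + 1 : ℕ)) + (h + 1 : ℕ) * Real.log 2 ≤ Δ / 2 ∧
      Δ / Real.log Δ ≤ 8 * (h + 1 : ℕ) := by
  have hlog : 0.6931471803 < Real.log 2 := Real.log_two_gt_d9
  have hlog₂ : Real.log 2 ≤ Real.log Δ := Real.log_le_log two_pos hΔ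
  have hlogpos : 0 < Real.log Δ := by linarith
  -- For b = h + 1, the 6 gives 2b log b + b log 2 ≤ 3b log Δ ≤ Δ/2. The threshold 18 gives b ≥ 3,
  -- hence h ≥ 2 and 6(b + 1) ≤ 8b.
  have hb₃ : 3 ≤ ⌊Δ / Real.log Δ / 6⌋₊ := Nat.le_floor (by push_cast; linarith)
  obtain ⟨h, hb⟩ : ∃ h, ⌊Δ / Real.log Δ / 6⌋₊ = h + 1 := ⟨_, (Nat.sub_add_cancel (by omega)).symm⟩
  have hlt := Nat.lt_floor_add_one (Δ / Real.log Δ / 6)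
  have hle := Nat.floor_le (show 0 ≤ Δ / Real.log Δ / 6 by linarith)
  rw [hb] at hb₃ hlt hle
  have hb₃' : (3 : ℝ) ≤ (h + 1 : ℕ) := by exact_mod_cast hb₃
  refine ⟨h, by omega, ?_, by linarith⟩
  have hmul : ((h + 1 : ℕ) : ℝ) * Real.log Δ * 6 ≤ Δ := by
    rw [div_div, le_div_iff₀ (by positivity)] at hle
    linarith
  have hbΔ : ((h + 1 : ℕ) : ℝ) ≤ Δ := by nlinarith
  have hlogb : Real.log (h + 1 : ℕ) ≤ Real.log Δ := Real.log_le_log (by linarith) hbΔ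
  have h₁ := mul_le_mul_of_nonneg_left hlogb (by linarith : (0 : ℝ) ≤ (h + 1 : ℕ))
  have h₂ := mul_le_mul_of_nonneg_left hlog₂ (by linarith : (0 : ℝ) ≤ (h + 1 : ℕ))
  linarith

theorem mainTheorem5 :
    ∃ c : ℝ, 0 < c ∧ ∀ Δ : ℝ, 2 ≤ Δ →
      ∃ (M : Type) (_ : Finite M) (_ : DecidableEq M) (_ : MetricSpace M) (f : ℝ≥0)
        (n : ℕ) (Ω : Fin n → Finset M) (X : MRF (fun i => Ω i)),
        X.weightedDegree = Δ ∧
        Pairwise (fun i j => Disjoint (Ω i) (Ω j)) ∧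
        0 < X.expect (fun u => (facilityLocation M fun _ => f).opt fun i => (u i : M)) ∧
        ∀ (R : Type) [MeasurableSpace R] (μ : Measure R) [IsProbabilityMeasure μ]
          (A : R → OnlineAlgorithm (facilityLocation M fun _ => f) n),
          (∀ (v : Fin n → M) (i : Fin n) (S : Finset (M ⊕ (M × M))),
            MeasurableSet {r | (A r).select v i = S}) →
          c * (Δ / Real.log Δ) *
              X.expect (fun u => (facilityLocation M fun _ => f).opt fun i => (u i : M)) ≤
            X.expect (fun u => ∫ r, (A r).cost (fun i => (u i : M)) ∂μ) := by

  -- 432 = 54 · 8, from the gap and the choice of depth. For small Δ / log Δ it is enough that no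
  -- algorithm beats the optimum.
  refine ⟨1 / 432, by norm_num, fun Δ hΔ => ?_⟩
  obtain ⟨h, hh, hgap⟩ : ∃ h : ℕ, 1 ≤ h ∧ (Δ / Real.log Δ ≤ 432 ∨ 2 ≤ h ∧
      2 * ((h + 1 : ℕ) * Real.log (h + 1 : ℕ)) + (h + 1 : ℕ) * Real.log 2 ≤ Δ / 2 ∧
      Δ / Real.log Δ ≤ 8 * (h + 1 : ℕ)) := by
    rcases le_total 18 (Δ / Real.log Δ) with hlarge | hsmall
    · obtain ⟨h, hh, hrest⟩ := exists_depth hΔ hlarge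
      exact ⟨h, by omega, Or.inr ⟨hh, hrest⟩⟩
    · exact ⟨1, le_rfl, Or.inl (by linarith)⟩
  have hopt : (0 : ℝ) < ((HardTree.geometric h hh).chain (Δ / 2)).expect fun u =>
      (facilityLocation (HardTree.geometric h hh).Pt
        fun _ => (((h + 1) * h : ℕ) : ℝ≥0)).opt (HardTree.clients u) := by
    refine lt_of_lt_of_le ?_ (HardTree.openCost_le_expect_opt (Δ / 2))
    rw [NNReal.coe_natCast]
    have : 0 < (h + 1) * h := by positivity
    exact_mod_cast this
  refine ⟨(HardTree.geometric h hh).Pt, inferInstance, inferInstance, inferInstance,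
    (((h + 1) * h : ℕ) : ℝ≥0), (HardTree.geometric h hh).N + 1, (HardTree.geometric h hh).types,
    (HardTree.geometric h hh).chain (Δ / 2), ?_, HardTree.types_disjoint, hopt, ?_⟩
  · rw [HardTree.chain_weightedDegree (by linarith) (HardTree.two_le_geometric_N hh)]
    ring
  · intro R _ μ _ A hA
    rcases hgap with hsmall | ⟨hh₂, hθ, hratio⟩
    · refine le_trans ?_ (HardTree.expect_opt_le_expect_cost (Δ / 2) μ hA)
      exact mul_le_of_le_one_left hopt.le (by linarith)
    · refine le_trans ?_ (HardTree.geometric_gap hh hh₂ hθ μ hA)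
      exact mul_le_mul_of_nonneg_right (by linarith) hopt.le
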